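/- Let $d\ge 1$ be an integer. For a finite set $C\subset\mathbb Z^d$ let $$\Theta_d(C):=\{(x,y)\in\mathbb Z^d\times\mathbb Z^d:\ |x-y|=1,\ x\in C,\ y\in\mathbb Z^d\setminus C\}$$ be its edge boundary, where $|\cdot|$ is the Euclidean norm, and for $n\in\mathbb N$ let $EIP^d(n):=\min\{\#\Theta_d(C):\ C\subset\mathbb Z^d,\ \#C=n\}$. A nonempty finite set $C\subset\mathbb Z^d$ is called an $EIP^d$ minimizer if $\#\Theta_d(C)=EIP^d(\#C)$; by convention, the empty set is an $EIP^d$ minimizer as well. The same definitions are used in dimension $0$, where $\mathbb Z^0$ is a single point. For $s\in\{1,\dots,d\}$ and $k\in\mathbb Z$ the $(d-1)$-dimensional section of $C$ is $S_{s,k}(C):=\{x\in C:\ x_s=k\}$; it is identified with a subset of $\mathbb Z^{d-1}$ by deleting the $s$-th coordinate. If $C\subset\mathbb Z^d$ is an $EIP^d$ minimizer, then for every $s\in\{1,\dots,d\}$ and every $k\in\mathbb Z$ the section $S_{s,k}(C)$, regarded as a subset of $\mathbb Z^{d-1}$, is an $EIP^{d-1}$ minimizer. -/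

import Mathlib

namespace EdgeIso

/-- The edge boundary `Θ_d(C)`: ordered pairs `(x, y)` of lattice points at Euclidean distance `1`
(equivalently, squared distance `1`) with `x ∈ C` and `y ∉ C`. -/
def edgeBoundary {d : ℕ} (C : Set (Fin d → ℤ)) : Set ((Fin d → ℤ) × (Fin d → ℤ)) :=
  {p | ∑ i, (p.1 i - p.2 i) ^ 2 = 1 ∧ p.1 ∈ C ∧ p.2 ∉ C}

/-- The edge perimeter `#Θ_d(C)`. The edge boundary of a finite set is finite, so that `Set.ncard`
is the genuine cardinality wherever it is used below. -/
noncomputable def edgePerimeter {d : ℕ} (C : Set (Fin d → ℤ)) : ℕ :=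
  (edgeBoundary C).ncard

/-- `EIP^d(n)`: the minimal edge perimeter among the `n`-point subsets of `ℤ^d`. The infimum of a
nonempty set of natural numbers is its minimum. -/
noncomputable def EIP (d n : ℕ) : ℕ :=
  sInf {m : ℕ | ∃ C : Set (Fin d → ℤ), C.Finite ∧ C.ncard = n ∧ edgePerimeter C = m}

/-- `EIP^d` minimizers: the empty set, and the nonempty finite sets `C ⊆ ℤ^d` whose edge perimeter
equals `EIP^d(#C)`. -/
def IsEIPMinimizer {d : ℕ} (C : Set (Fin d → ℤ)) : Prop :=
  C = ∅ ∨ (C.Nonempty ∧ C.Finite ∧ edgePerimeter C = EIP d C.ncard)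

/-- The section `S_{s,k}(C) = {x ∈ C : e_s · x = k}`. -/
def latticeSection {d : ℕ} (C : Set (Fin d → ℤ)) (s : Fin d) (k : ℤ) : Set (Fin d → ℤ) :=
  {x ∈ C | x s = k}

/-- The map `ℤ^(d+1) → ℤ^d` that deletes the coordinate `s`; it identifies each hyperplane
`{x : x s = k}` with `ℤ^d`. -/
def dropCoord {d : ℕ} (s : Fin (d + 1)) (x : Fin (d + 1) → ℤ) : Fin d → ℤ :=
  fun i => x (s.succAbove i)

end EdgeIso

/-!
The perimeter of `C ⊆ ℤ^(d+1)` is the sum of the perimeters of its sections `C_k` in a fixed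
direction plus the sum of the numbers `#(C_k ∆ C_{k+1})`. Suppose that `ℤ^d` has an increasing
sequence of minimizers, one of each cardinality, and replace every section of `C` by the member
of this sequence with the same number of points. No section perimeter increases, and neither does
any `#(C_k ∆ C_{k+1})`, which becomes `|#C_k - #C_{k+1}|`. If `C` is a minimizer then no term can
decrease either, so every section was already a minimizer.

Such a sequence consists of the quasi-cubes, with incomplete faces filled by the sequence one
dimension lower. Its minimality follows by induction on the cardinality. A set of `n > a^(d+1)`
points has a nonempty section of `r ≤ n / (a + 1)` points; deleting it and closing the gap lowers
the perimeter by at least that of the section. If `n ≤ (a + 1)^(d+1)`, the perimeter of the `n`-th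
set of the sequence is at most that of the `(n - r)`-th plus that of the `r`-th one dimension
lower. This last inequality reduces to the fact that filling up one face of a quasi-cube with the
points of another does not increase their total perimeter.
-/

namespace EdgeIso

open Finset
open scoped symmDiff

variable {d : ℕ}

/-- The edge perimeter of a finite set, counted by directions `i` and orientations `ε`. -/
def perimeter (C : Finset (Fin d → ℤ)) : ℕ :=
  ∑ i, ∑ ε : ℤˣ, #{x ∈ C | x + Pi.single i (ε : ℤ) ∉ C}

theorem sum_sq_eq_one_iff {ι : Type*} [Fintype ι] [DecidableEq ι] {z : ι → ℤ} :
    ∑ i, z i ^ 2 = 1 ↔ ∃ (i : ι) (ε : ℤˣ), z = Pi.single i (ε : ℤ) := by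
  constructor
  · intro h
    obtain ⟨i, hi⟩ : ∃ i, z i ≠ 0 := by
      by_contra! hz
      simp [hz] at h
    have h_sum := add_sum_erase univ (z · ^ 2) (mem_univ i)
    have h_nonneg : ∀ j ∈ univ.erase i, 0 ≤ z j ^ 2 := fun j _ ↦ sq_nonneg (z j)
    have h_rest := sum_nonneg h_nonneg
    have h_pos : 0 < z i ^ 2 := by positivity
    have h_unit : IsUnit (z i) := by
      rw [Int.isUnit_iff, ← sq_eq_one_iff]
      omega
    have h_zero : ∀ j ≠ i, z j = 0 := fun j hj ↦ by
      simpa using (sum_eq_zero_iff_of_nonneg h_nonneg).1 (by omega) j (by simpa using hj)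
    refine ⟨i, h_unit.unit, funext fun j ↦ ?_⟩
    obtain rfl | hj := eq_or_ne j i
    · simp
    · simp [hj, h_zero]
  · rintro ⟨i, ε, rfl⟩
    simp [Pi.single_apply, Int.units_eq_one_or]

theorem single_unit_injective {ι : Type*} [DecidableEq ι] :
    Function.Injective fun q : ι × ℤˣ ↦ (Pi.single q.1 (q.2 : ℤ) : ι → ℤ) := by
  rintro ⟨i, ε⟩ ⟨j, η⟩ h
  obtain rfl : i = j := by
    by_contra hij
    simpa [Pi.single_eq_of_ne hij] using congrFun h i
  simpa [Units.val_inj] using h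

theorem edgePerimeter_coe (C : Finset (Fin d → ℤ)) :
    edgePerimeter (C : Set (Fin d → ℤ)) = perimeter C := by
  let edge (q : (Fin d → ℤ) × Fin d × ℤˣ) := (q.1, q.1 + Pi.single q.2.1 (q.2.2 : ℤ))
  have edge_injective : Function.Injective edge := by
    rintro ⟨x, q⟩ ⟨y, r⟩ h
    obtain ⟨rfl, h⟩ := Prod.ext_iff.1 h
    exact Prod.ext rfl (single_unit_injective (add_left_cancel h))
  have edgeBoundary_eq : edgeBoundary (C : Set (Fin d → ℤ)) =
      edge '' ({q ∈ C ×ˢ univ | (edge q).2 ∉ C} : Finset _) := by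
    ext ⟨x, y⟩
    have h_sq : ∑ i, (x i - y i) ^ 2 = 1 ↔
        ∃ (i : Fin d) (ε : ℤˣ), y = x + Pi.single i (ε : ℤ) := by
      rw [sum_congr rfl fun i _ ↦ sub_sq_comm (x i) (y i)]
      exact sum_sq_eq_one_iff (z := y - x) |>.trans (by simp only [sub_eq_iff_eq_add'])
    simp only [edgeBoundary, Set.mem_ofPred_eq, h_sq]
    constructor
    · rintro ⟨⟨i, ε, rfl⟩, hx, hy⟩
      exact ⟨(x, i, ε), by simpa [edge] using ⟨hx, hy⟩, rfl⟩
    · rintro ⟨⟨z, i, ε⟩, hz, h⟩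
      obtain ⟨rfl, rfl⟩ := Prod.ext_iff.1 h
      exact ⟨⟨i, ε, rfl⟩, by simpa [edge] using hz⟩
  rw [edgePerimeter, edgeBoundary_eq, Set.ncard_image_of_injective _ edge_injective,
    Set.ncard_coe_finset, perimeter, card_filter, sum_product_right, Fintype.sum_prod_type]
  simp only [edge, card_filter]

theorem isEIPMinimizer_coe_iff {C : Finset (Fin d → ℤ)} :
    IsEIPMinimizer (C : Set (Fin d → ℤ)) ↔
      ∀ D : Finset (Fin d → ℤ), #D = #C → perimeter C ≤ perimeter D := by
  have mem_perimeters {m : ℕ} :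
      m ∈ {m : ℕ | ∃ D : Set (Fin d → ℤ), D.Finite ∧ D.ncard = #C ∧ edgePerimeter D = m} ↔
        ∃ D : Finset (Fin d → ℤ), #D = #C ∧ perimeter D = m := by
    simp [Set.exists_finite_iff_finset, Set.ncard_coe_finset, edgePerimeter_coe]
  have perimeter_eq_EIP_iff : perimeter C = EIP d #C ↔
      ∀ D : Finset (Fin d → ℤ), #D = #C → perimeter C ≤ perimeter D := by
    refine ⟨fun h D hD ↦ h ▸ Nat.sInf_le (mem_perimeters.2 ⟨D, hD, rfl⟩), fun h ↦ ?_⟩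
    refine (IsLeast.csInf_eq ⟨mem_perimeters.2 ⟨C, rfl, rfl⟩, fun m hm ↦ ?_⟩).symm
    obtain ⟨D, hD, rfl⟩ := mem_perimeters.1 hm
    exact h D hD
  rw [IsEIPMinimizer, edgePerimeter_coe, Set.ncard_coe_finset, perimeter_eq_EIP_iff]
  obtain rfl | hC := C.eq_empty_or_nonempty
  · simp [perimeter]
  · simp [hC, hC.ne_empty]

/-! ### Sections -/

section Slices

variable {s : Fin (d + 1)}

/-- The section of `C` in the hyperplane `x s = k`, as a subset of `ℤ^d`. -/
def slice (s : Fin (d + 1)) (k : ℤ) (C : Finset (Fin (d + 1) → ℤ)) : Finset (Fin d → ℤ) :=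
  image s.removeNth {x ∈ C | x s = k}

variable {k : ℤ} {y : Fin d → ℤ} {C D : Finset (Fin (d + 1) → ℤ)}

theorem coe_slice :
    (slice s k C : Set (Fin d → ℤ)) = dropCoord s '' latticeSection C s k := by
  simp only [slice, coe_image, coe_filter]
  rfl

theorem mem_slice : y ∈ slice s k C ↔ s.insertNth k y ∈ C := by
  simp only [slice, mem_image, mem_filter]
  constructor
  · rintro ⟨x, ⟨hx, rfl⟩, rfl⟩
    simpa using hx
  · intro h
    exact ⟨_, ⟨h, by simp⟩, by simp⟩

theorem ext_slice (s : Fin (d + 1)) (h : ∀ k, slice s k C = slice s k D) : C = D := by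
  ext x
  rw [← s.insertNth_self_removeNth x, ← mem_slice, ← mem_slice, h]

theorem exists_forall_slice_eq (s : Fin (d + 1)) {K : Finset ℤ} {A : ℤ → Finset (Fin d → ℤ)}
    (hA : ∀ k ∉ K, A k = ∅) : ∃ C : Finset (Fin (d + 1) → ℤ), ∀ k, slice s k C = A k := by
  refine ⟨K.biUnion fun k ↦ (A k).image (s.insertNth k), fun k ↦ ?_⟩
  ext y
  simp only [mem_slice, mem_biUnion, mem_image, Fin.insertNth_inj]
  have : y ∈ A k → k ∈ K := fun hy ↦ by_contra fun hk ↦ by simp [hA k hk] at hy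
  aesop

theorem exists_forall_notMem_slice_eq_empty (s : Fin (d + 1)) (C : Finset (Fin (d + 1) → ℤ))
    (L : Finset ℤ) :
    ∃ K ⊇ L, ∀ k ∉ K, slice s k C = ∅ ∧ slice s (k + 1) C = ∅ := by
  refine ⟨L ∪ C.image (· s) ∪ C.image (· s - 1), by grind, fun k hk ↦ ?_⟩
  simp only [mem_union, mem_image, not_or, not_exists, not_and] at hk
  constructor <;> refine eq_empty_of_forall_notMem fun y hy ↦ ?_
  · exact hk.1.2 _ (mem_slice.1 hy) (by simp)
  · exact hk.2 _ (mem_slice.1 hy) (by simp)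

variable {K : Finset ℤ}

theorem card_filter_eq_sum_slice (hK : ∀ k ∉ K, slice s k C = ∅)
    (p : (Fin (d + 1) → ℤ) → Prop) [DecidablePred p] :
    #{x ∈ C | p x} = ∑ k ∈ K, #{y ∈ slice s k C | p (s.insertNth k y)} := by
  have apply_mem : ∀ x ∈ C, x s ∈ K := fun x hx ↦ by_contra fun h ↦
    notMem_empty (s.removeNth x) (hK _ h ▸ mem_slice.2 (by simpa using hx))
  rw [card_eq_sum_card_fiberwise fun x hx ↦ apply_mem x (mem_filter.1 hx).1]
  refine sum_congr rfl fun k _ ↦ ?_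
  rw [← card_image_of_injective (slice s k C |>.filter _)
    (Fin.insertNth_right_injective (α := fun _ ↦ ℤ) (p := s) k)]
  congr 1
  ext x
  simp only [mem_filter, mem_image, mem_slice]
  constructor
  · rintro ⟨⟨hx, hp⟩, rfl⟩
    exact ⟨s.removeNth x, by simpa using ⟨hx, hp⟩, by simp⟩
  · rintro ⟨y, hy, rfl⟩
    simpa using hy

theorem card_eq_sum_slice (hK : ∀ k ∉ K, slice s k C = ∅) : #C = ∑ k ∈ K, #(slice s k C) := by
  simpa using card_filter_eq_sum_slice hK fun _ ↦ True

theorem insertNth_add_single_self (s : Fin (d + 1)) (k ε : ℤ) (y : Fin d → ℤ) :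
    (s.insertNth k y + Pi.single s ε : Fin (d + 1) → ℤ) = s.insertNth (k + ε) y := by
  rw [Fin.eq_insertNth_iff]
  exact ⟨by simp, funext fun i ↦ by simp [Fin.removeNth]⟩

theorem insertNth_add_single_succAbove (s : Fin (d + 1)) (i : Fin d) (k ε : ℤ) (y : Fin d → ℤ) :
    (s.insertNth k y + Pi.single (s.succAbove i) ε : Fin (d + 1) → ℤ) =
      s.insertNth k (y + Pi.single i ε) := by
  rw [Fin.eq_insertNth_iff]
  refine ⟨by simp [(Fin.succAbove_ne s i).symm], ?_⟩
  ext l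
  simp [Fin.removeNth, Pi.single_apply]

theorem card_symmDiff {α : Type*} [DecidableEq α] (s t : Finset α) :
    #(s ∆ t) = #(s \ t) + #(t \ s) :=
  card_union_of_disjoint disjoint_sdiff_sdiff

theorem sum_add_one_eq {f : ℤ → ℕ} (hf : ∀ k ∉ K, f k = 0 ∧ f (k + 1) = 0) :
    ∑ k ∈ K, f (k + 1) = ∑ k ∈ K, f k := by
  rw [← finsum_eq_sum_of_support_subset f (s := K), ← finsum_eq_sum_of_support_subset _ (s := K)]
  · exact finsum_comp_equiv (Equiv.addRight (1 : ℤ))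
  · exact fun k hk ↦ by_contra fun h ↦ hk (hf k h).2
  · exact fun k hk ↦ by_contra fun h ↦ hk (hf k h).1

theorem perimeter_eq_sum_slice (hK : ∀ k ∉ K, slice s k C = ∅ ∧ slice s (k + 1) C = ∅) :
    perimeter C = ∑ k ∈ K, (perimeter (slice s k C) + #(slice s k C ∆ slice s (k + 1) C)) := by
  have h_slice : ∀ k ∉ K, slice s k C = ∅ := fun k hk ↦ (hK k hk).1
  have h_normal : ∑ ε : ℤˣ, #{x ∈ C | x + Pi.single s (ε : ℤ) ∉ C} =
      ∑ k ∈ K, #(slice s k C ∆ slice s (k + 1) C) := by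
    have h (ε : ℤ) : #{x ∈ C | x + Pi.single s ε ∉ C} =
        ∑ k ∈ K, #(slice s k C \ slice s (k + ε) C) := by
      simp only [card_filter_eq_sum_slice h_slice, insertNth_add_single_self, ← mem_slice,
        filter_notMem_eq_sdiff]
    have h_shift : ∑ k ∈ K, #(slice s k C \ slice s (k - 1) C) =
        ∑ k ∈ K, #(slice s (k + 1) C \ slice s k C) := by
      simpa using (sum_add_one_eq (K := K) (f := fun k ↦ #(slice s k C \ slice s (k - 1) C))
        fun k hk ↦ by simp [hK k hk]).symm
    simp [UnitsInt.univ, h, card_symmDiff, sum_add_distrib, ← h_shift, sub_eq_add_neg]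
  have h_parallel (i : Fin d) (ε : ℤˣ) :
      #{x ∈ C | x + Pi.single (s.succAbove i) (ε : ℤ) ∉ C} =
        ∑ k ∈ K, #{y ∈ slice s k C | y + Pi.single i (ε : ℤ) ∉ slice s k C} := by
    simp only [card_filter_eq_sum_slice h_slice, insertNth_add_single_succAbove, ← mem_slice]
  simp only [perimeter, Fin.sum_univ_succAbove _ s, h_normal, h_parallel]
  rw [sum_add_distrib, add_comm]
  simp only [sum_comm (s := K)]

/-- The set obtained from `C` by placing a copy of `T` in the hyperplane `x s = k`. -/
def addLayer (s : Fin (d + 1)) (k : ℤ) (T : Finset (Fin d → ℤ)) (C : Finset (Fin (d + 1) → ℤ)) :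
    Finset (Fin (d + 1) → ℤ) :=
  C ∪ T.image (s.insertNth k)

variable {T U : Finset (Fin d → ℤ)} {l : ℤ}

theorem slice_addLayer_self : slice s k (addLayer s k T C) = slice s k C ∪ T := by
  ext y
  simp [mem_slice, addLayer, Fin.insertNth_inj]

theorem slice_addLayer_of_ne (hl : l ≠ k) : slice s l (addLayer s k T C) = slice s l C := by
  ext y
  simp [mem_slice, addLayer, Fin.insertNth_inj, hl.symm]

theorem addLayer_mono (h : T ⊆ U) : addLayer s k T C ⊆ addLayer s k U C :=
  union_subset_union_right (image_subset_image h)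

theorem card_addLayer (hC : slice s k C = ∅) : #(addLayer s k T C) = #C + #T := by
  rw [addLayer, card_union_of_disjoint,
    card_image_of_injective _ (Fin.insertNth_right_injective (α := fun _ ↦ ℤ) k)]
  rw [disjoint_right, forall_mem_image]
  intro y _ hy
  simpa [hC] using mem_slice.2 hy

theorem perimeter_addLayer (hk : slice s k C = ∅) (hk_succ : slice s (k + 1) C = ∅)
    (hT : T ⊆ slice s (k - 1) C) :
    perimeter (addLayer s k T C) = perimeter C + perimeter T := by
  obtain ⟨K, hkK, hK⟩ := exists_forall_notMem_slice_eq_empty s C {k, k - 1}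
  simp only [insert_subset_iff, singleton_subset_iff] at hkK
  have hK_add : ∀ l ∉ K, slice s l (addLayer s k T C) = ∅ ∧
      slice s (l + 1) (addLayer s k T C) = ∅ := fun l hl ↦ by
    rw [slice_addLayer_of_ne (by grind), slice_addLayer_of_ne (by grind)]
    exact hK l hl
  have h_summand (l : ℤ) : perimeter (slice s l (addLayer s k T C)) +
        #(slice s l (addLayer s k T C) ∆ slice s (l + 1) (addLayer s k T C)) +
        (if l = k - 1 then #T else 0) =
      perimeter (slice s l C) + #(slice s l C ∆ slice s (l + 1) C) +
        (if l = k then perimeter T + #T else 0) := by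
    obtain rfl | hl := eq_or_ne l k
    · rw [if_neg (by omega), if_pos rfl]
      simp [slice_addLayer_self, slice_addLayer_of_ne, hk, hk_succ, perimeter, card_symmDiff]
    obtain rfl | hl' := eq_or_ne l (k - 1)
    · rw [sub_add_cancel, slice_addLayer_self, slice_addLayer_of_ne hl, hk, if_pos rfl, if_neg hl]
      simp [card_symmDiff, sdiff_eq_empty_iff_subset.2 hT, card_sdiff_add_card_eq_card hT,
        add_assoc]
    · rw [slice_addLayer_of_ne hl, slice_addLayer_of_ne (by omega), if_neg hl, if_neg hl']
  have h_sum := sum_congr rfl fun l (_ : l ∈ K) ↦ h_summand l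
  rw [perimeter_eq_sum_slice hK, perimeter_eq_sum_slice hK_add]
  simp only [sum_add_distrib, sum_ite_eq', hkK, if_true] at h_sum ⊢
  omega

/-- The increasing bijection from `ℤ` onto `{k}ᶜ`. -/
def skip (k j : ℤ) : ℤ := if j < k then j else j + 1

theorem skip_injective (k : ℤ) : Function.Injective (skip k) := fun i j ↦ by
  unfold skip
  grind

theorem range_skip (k : ℤ) : Set.range (skip k) = {k}ᶜ := by
  ext l
  simp only [Set.mem_range, Set.mem_compl_singleton_iff]
  constructor
  · rintro ⟨j, rfl⟩
    unfold skip
    grind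
  · intro hl
    obtain h | h := hl.lt_or_gt
    · exact ⟨l, if_pos h⟩
    · exact ⟨l - 1, by unfold skip; grind⟩

theorem skip_add_one (k j : ℤ) :
    skip k (j + 1) = if j = k - 1 then k + 1 else skip k j + 1 := by
  unfold skip
  grind

theorem card_symmDiff_skip_le {α : Type*} [DecidableEq α] (A : ℤ → Finset α) (k j : ℤ) :
    #(A (skip k j) ∆ A (skip k (j + 1))) ≤ #(A (skip k j) ∆ A (skip k j + 1)) +
      if j = k - 1 then #(A k ∆ A (k + 1)) else 0 := by
  rw [skip_add_one]
  split_ifs with hj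
  · have h_skip : skip k j + 1 = k := by
      unfold skip
      grind
    rw [h_skip]
    exact (card_le_card (symmDiff_triangle _ _ _)).trans (card_union_le _ _)
  · simp

theorem exists_perimeter_add_slice_le (s : Fin (d + 1)) (k : ℤ) (C : Finset (Fin (d + 1) → ℤ)) :
    ∃ D : Finset (Fin (d + 1) → ℤ), #D + #(slice s k C) = #C ∧
      perimeter D + perimeter (slice s k C) ≤ perimeter C := by
  obtain ⟨K, hkK, hK⟩ := exists_forall_notMem_slice_eq_empty s C {k, k - 1}
  simp only [insert_subset_iff, singleton_subset_iff] at hkK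
  let K' := K.preimage (skip k) (skip_injective k).injOn
  have mem_K' {j : ℤ} : j ∈ K' ↔ skip k j ∈ K := mem_preimage
  have sum_skip_add (f : ℤ → ℕ) : ∑ j ∈ K', f (skip k j) + f k = ∑ l ∈ K, f l := by
    classical
    rw [sum_preimage', ← sum_erase_add K f hkK.1, ← filter_ne']
    simp only [range_skip, Set.mem_compl_singleton_iff]
  obtain ⟨D, hD⟩ := exists_forall_slice_eq s (K := K') (A := fun j ↦ slice s (skip k j) C)
    fun j hj ↦ (hK _ (mem_K'.not.1 hj)).1
  have hK' : ∀ j ∉ K', slice s j D = ∅ ∧ slice s (j + 1) D = ∅ := fun j hj ↦ by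
    have hj' := hK _ (mem_K'.not.1 hj)
    have : j ≠ k - 1 := by
      rintro rfl
      exact hj (mem_K'.2 (by simpa [skip] using hkK.2))
    simpa [hD, skip_add_one, this] using hj'
  refine ⟨D, ?_, ?_⟩
  · rw [card_eq_sum_slice fun l hl ↦ (hK l hl).1, card_eq_sum_slice fun j hj ↦ (hK' j hj).1,
      ← sum_skip_add]
    simp only [hD]
  · rw [perimeter_eq_sum_slice hK, perimeter_eq_sum_slice hK', ← sum_skip_add]
    simp only [hD, sum_add_distrib]
    -- The triangle inequality for `∆`, across the gap closed between `k - 1` and `k + 1`.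
    have h_gap := sum_le_sum fun j (_ : j ∈ K') ↦ card_symmDiff_skip_le (slice s · C) k j
    rw [sum_add_distrib, sum_ite_eq', if_pos (mem_K'.2 (by simpa [skip] using hkK.2))] at h_gap
    omega

end Slices

/-! ### Quasi-cubes -/

/-- The number of points of a quasi-cube in `ℤ^d` with `j` sides of length `a + 1` and `d - j`
sides of length `a`. -/
def boxCard (d a j : ℕ) : ℕ := a ^ (d - j) * (a + 1) ^ j

section BoxCard

variable {a a' j j' t n : ℕ}

theorem boxCard_pos (ha : 1 ≤ a) : 0 < boxCard d a j := by
  unfold boxCard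
  positivity

theorem boxCard_zero_right (d a : ℕ) : boxCard d a 0 = a ^ d := by simp [boxCard]

theorem boxCard_self (d a : ℕ) : boxCard d a d = (a + 1) ^ d := by simp [boxCard]

theorem boxCard_succ_eq_mul (hj : j ≤ d) : boxCard (d + 1) a j = a * boxCard d a j := by
  rw [boxCard, boxCard, Nat.succ_sub hj, pow_succ']
  ring

theorem boxCard_succ_succ_eq_mul (d a j : ℕ) :
    boxCard (d + 1) a (j + 1) = (a + 1) * boxCard d a j := by
  rw [boxCard, boxCard, Nat.succ_sub_succ]
  ring

theorem boxCard_succ_succ (hj : j ≤ d) :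
    boxCard (d + 1) a (j + 1) = boxCard (d + 1) a j + boxCard d a j := by
  rw [boxCard_succ_eq_mul hj, boxCard_succ_succ_eq_mul, add_one_mul]

theorem boxCard_mono_right (hj : j ≤ j') (hj' : j' ≤ d) : boxCard d a j ≤ boxCard d a j' := by
  calc a ^ (d - j) * (a + 1) ^ j = a ^ (d - j') * a ^ (j' - j) * (a + 1) ^ j := by
        rw [← pow_add]
        congr 2
        omega
    _ ≤ a ^ (d - j') * (a + 1) ^ (j' - j) * (a + 1) ^ j := by
        gcongr
        omega
    _ = a ^ (d - j') * (a + 1) ^ j' := by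
        rw [mul_assoc, ← pow_add, Nat.sub_add_cancel hj]

theorem boxCard_le_succ_pow (hj : j ≤ d) : boxCard d a j ≤ (a + 1) ^ d :=
  boxCard_self d a ▸ boxCard_mono_right hj le_rfl

theorem pow_le_boxCard (hj : j ≤ d) : a ^ d ≤ boxCard d a j :=
  boxCard_zero_right d a ▸ boxCard_mono_right (Nat.zero_le j) hj

theorem boxCard_le_boxCard_of_lt (h : a' < a) (hj : j ≤ d) (hj' : j' ≤ d) :
    boxCard d a' j' ≤ boxCard d a j :=
  calc boxCard d a' j' ≤ (a' + 1) ^ d := boxCard_le_succ_pow hj'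
    _ ≤ a ^ d := Nat.pow_le_pow_left h d
    _ ≤ boxCard d a j := pow_le_boxCard hj

theorem lex_of_boxCard_lt (hj : j ≤ d) (hj' : j' ≤ d)
    (h : boxCard (d + 1) a' j' < boxCard (d + 1) a (j + 1)) : a' < a ∨ (a' = a ∧ j' ≤ j) := by
  contrapose! h
  obtain ha | rfl := (h.1).lt_or_eq
  · exact boxCard_le_boxCard_of_lt ha (by omega) (by omega)
  · exact boxCard_mono_right (h.2 rfl) (by omega)

theorem boxCard_face_le (hj : j ≤ d) (hj' : j' ≤ d)
    (h : boxCard (d + 1) a' j' < boxCard (d + 1) a (j + 1)) :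
    boxCard d a' j' ≤ boxCard d a j := by
  obtain ha | ⟨rfl, hjj⟩ := lex_of_boxCard_lt hj hj' h
  · exact boxCard_le_boxCard_of_lt ha hj hj'
  · exact boxCard_mono_right hjj hj

theorem exists_boxCard_pred (ha : 1 ≤ a) (hj : j ≤ d + 1) :
    (a = 1 ∧ j = 0) ∨ ∃ a' i, 1 ≤ a' ∧ i ≤ d ∧
      ((a = a' ∧ j = i + 1) ∨ (a = a' + 1 ∧ j = 0 ∧ i = d)) ∧
        boxCard (d + 1) a j = boxCard (d + 1) a' (i + 1) := by
  obtain _ | i := j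
  · obtain rfl | ha := ha.eq_or_lt
    · simp
    · refine .inr ⟨a - 1, d, by omega, le_rfl, .inr ⟨by omega, rfl, rfl⟩, ?_⟩
      rw [boxCard_zero_right, boxCard_self, Nat.sub_add_cancel ha.le]
  · exact .inr ⟨a, i, ha, by omega, .inl ⟨rfl, rfl⟩, rfl⟩

/-- The triple `(a, j, t)` for which `n + 1` points form the quasi-cube with parameters `a`, `j` in
`ℤ^(d+1)` together with `t` points of its next, incomplete face. -/
def stage (d : ℕ) : ℕ → ℕ × Fin (d + 1) × ℕ
  | 0 => (1, 0, 0)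
  | n + 1 =>
    let (a, j, t) := stage d n
    if t + 1 < boxCard d a j then (a, j, t + 1)
    else if h : j + 1 < d + 1 then (a, ⟨j + 1, h⟩, 0)
    else (a + 1, 0, 0)

theorem exists_stage_eq (d n : ℕ) :
    ∃ a j t, stage d n = (a, j, t) ∧ 1 ≤ a ∧ t < boxCard d a j ∧
      n + 1 = boxCard (d + 1) a j + t := by
  induction n with
  | zero => exact ⟨1, 0, 0, by simp [stage, boxCard]⟩
  | succ n ih =>
    obtain ⟨a, j, t, h_stage, ha, ht, hn⟩ := ih
    have h_face := boxCard_succ_succ (a := a) j.is_le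
    rw [stage, h_stage]
    dsimp only
    split_ifs with h_next hj
    · exact ⟨_, _, _, rfl, ha, h_next, by omega⟩
    · exact ⟨_, _, _, rfl, ha, boxCard_pos ha, by dsimp only; omega⟩
    · have h_cube : boxCard (d + 1) a (j + 1) = boxCard (d + 1) (a + 1) 0 := by
        rw [boxCard_zero_right, ← boxCard_self]
        congr
        omega
      exact ⟨_, _, _, rfl, by omega, boxCard_pos (by omega), by rw [Fin.val_zero]; omega⟩

theorem exists_boxCard_add (d : ℕ) (hn : 2 ≤ n) :
    ∃ a j t, 1 ≤ a ∧ j ≤ d ∧ 0 < t ∧ t ≤ boxCard d a j ∧ n = boxCard (d + 1) a j + t := by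
  obtain ⟨a, j, t, -, ha, ht, h⟩ := exists_stage_eq d (n - 2)
  exact ⟨a, j, t + 1, ha, j.is_le, Nat.succ_pos t, ht, by omega⟩

theorem stage_eq {j : Fin (d + 1)} (ht : t < boxCard d a j)
    (hn : n + 1 = boxCard (d + 1) a j + t) : stage d n = (a, j, t) := by
  obtain ⟨a', j', t', h_stage, -, ht', hn'⟩ := exists_stage_eq d n
  have h_face := boxCard_succ_succ (a := a) j.is_le
  have h_face' := boxCard_succ_succ (a := a') j'.is_le
  have h_lex := lex_of_boxCard_lt (a := a) (a' := a') j.is_le j'.is_le (by omega)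
  have h_lex' := lex_of_boxCard_lt (a := a') (a' := a) j'.is_le j.is_le (by omega)
  obtain rfl : a = a' := by omega
  obtain rfl : j = j' := by omega
  obtain rfl : t = t' := by omega
  exact h_stage

end BoxCard

section Chain

variable {a j t : ℕ} {k : ℤ}

/-- The quasi-cube whose first `j` sides have length `a + 1` and whose other sides have
length `a`. -/
noncomputable def box (d a j : ℕ) : Finset (Fin d → ℤ) :=
  Fintype.piFinset fun i ↦ Ico 0 (if (i : ℕ) < j then (a : ℤ) + 1 else a)

theorem card_box (hj : j ≤ d) : #(box d a j) = boxCard d a j := by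
  have h_side (i : Fin d) : #(Ico (0 : ℤ) (if (i : ℕ) < j then (a : ℤ) + 1 else a)) =
      if (i : ℕ) < j then a + 1 else a := by
    split_ifs <;> simp
  have h_not : #{i : Fin d | ¬(i : ℕ) < j} = d - j := by
    rw [filter_not, card_sdiff_of_subset (filter_subset _ _)]
    simp [Fin.card_filter_val_lt, hj]
  simp only [box, Fintype.card_piFinset, h_side, prod_ite, prod_const, h_not,
    Fin.card_filter_val_lt, min_eq_right hj]
  rw [boxCard, mul_comm]

theorem box_self (d a : ℕ) : box d a d = box d (a + 1) 0 := by
  simp [box]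

theorem slice_box (j : Fin (d + 1)) :
    slice j k (box (d + 1) a j) = if k ∈ Ico 0 (a : ℤ) then box d a j else ∅ := by
  ext y
  have h_lt (i : Fin d) : (j.succAbove i : ℕ) < j ↔ (i : ℕ) < j := by
    grind [Fin.succAbove_lt_iff_castSucc_lt]
  split_ifs <;> simp_all [mem_slice, box, Fin.forall_iff_succAbove j]

theorem slice_box_succ (j : Fin (d + 1)) :
    slice j k (box (d + 1) a (j + 1)) = if k ∈ Ico 0 (a + 1 : ℤ) then box d a j else ∅ := by
  ext y
  have h_lt (i : Fin d) : (j.succAbove i : ℕ) < j + 1 ↔ (i : ℕ) < j := by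
    grind [Fin.succAbove]
  split_ifs <;> simp_all [mem_slice, box, Fin.forall_iff_succAbove j]

theorem addLayer_box (j : Fin (d + 1)) :
    addLayer j a (box d a j) (box (d + 1) a j) = box (d + 1) a (j + 1) := by
  refine ext_slice j fun k ↦ ?_
  rw [slice_box_succ]
  obtain rfl | hk := eq_or_ne k a
  · simp [slice_addLayer_self, slice_box]
  · rw [slice_addLayer_of_ne hk, slice_box]
    congr 1
    simp only [mem_Ico]
    grind

/-- A nested sequence of sets in `ℤ^d`, the `n`-th of which has `n` points if `d ≠ 0` or `n ≤ 1`: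
the quasi-cubes in increasing order, whose missing faces are filled by the sequence of
`ℤ^(d-1)`. -/
noncomputable def chain : (d : ℕ) → ℕ → Finset (Fin d → ℤ)
  | 0, n => if n = 0 then ∅ else univ
  | _ + 1, 0 => ∅
  | d + 1, n + 1 =>
    let (a, j, t) := stage d n
    addLayer j a (chain d t) (box (d + 1) a j)

theorem chain_zero_right (d : ℕ) : chain d 0 = ∅ := by
  cases d <;> simp [chain]

theorem chain_boxCard_add_of_lt {j : Fin (d + 1)} (ha : 1 ≤ a) (ht : t < boxCard d a j) :
    chain (d + 1) (boxCard (d + 1) a j + t) = addLayer j a (chain d t) (box (d + 1) a j) := by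
  obtain ⟨n, hn⟩ : ∃ n, boxCard (d + 1) a j + t = n + 1 :=
    Nat.exists_eq_add_one.2 (Nat.add_pos_left (boxCard_pos ha) t)
  rw [hn, chain, stage_eq ht hn.symm]

theorem chain_boxCard (ha : 1 ≤ a) (hj : j ≤ d) : chain d (boxCard d a j) = box d a j := by
  have chain_incomplete {d a : ℕ} (j : Fin (d + 1)) (ha : 1 ≤ a) :
      chain (d + 1) (boxCard (d + 1) a j) = box (d + 1) a j := by
    simpa [chain_zero_right, addLayer] using chain_boxCard_add_of_lt ha (boxCard_pos (j := j) ha)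
  obtain _ | d := d
  · obtain rfl : j = 0 := by omega
    simp [boxCard, box, chain]
  · obtain hj | rfl := hj.lt_or_eq
    · exact chain_incomplete ⟨j, hj⟩ ha
    · rw [boxCard_self, ← boxCard_zero_right, box_self]
      exact chain_incomplete 0 (by omega)

theorem chain_boxCard_add {j : Fin (d + 1)} (ha : 1 ≤ a) (ht : t ≤ boxCard d a j) :
    chain (d + 1) (boxCard (d + 1) a j + t) = addLayer j a (chain d t) (box (d + 1) a j) := by
  obtain ht | rfl := ht.lt_or_eq
  · exact chain_boxCard_add_of_lt ha ht
  · rw [← boxCard_succ_succ j.is_le, chain_boxCard ha (by omega), chain_boxCard ha j.is_le,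
      addLayer_box]

theorem chain_mono (d : ℕ) : Monotone (chain d) := by
  induction d with
  | zero =>
    refine monotone_nat_of_le_succ fun n ↦ ?_
    simp only [chain]
    split_ifs <;> simp_all
  | succ d ih =>
    refine monotone_nat_of_le_succ fun n ↦ ?_
    obtain _ | n := n
    · simp [chain_zero_right]
    · obtain ⟨a, j, t, -, ha, ht, h⟩ := exists_stage_eq d n
      rw [h, add_assoc, chain_boxCard_add ha ht.le, chain_boxCard_add ha ht]
      exact addLayer_mono (ih t.le_succ)

theorem card_chain {n : ℕ} (h : d = 0 → n ≤ 1) : #(chain d n) = n := by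
  induction d generalizing n with
  | zero =>
    have := h rfl
    interval_cases n <;> simp [chain]
  | succ d ih =>
    obtain _ | n := n
    · simp [chain]
    · obtain ⟨a, j, t, -, ha, ht, h⟩ := exists_stage_eq d n
      rw [h, chain_boxCard_add ha ht.le, card_addLayer (by simp [slice_box]), card_box (by omega),
        ih]
      rintro rfl
      exact ht.le.trans (boxCard_le_succ_pow j.is_le)

theorem perimeter_of_card_eq_one {C : Finset (Fin d → ℤ)} (hC : #C = 1) :
    perimeter C = 2 * d := by
  obtain ⟨x, rfl⟩ := card_eq_one.1 hC
  simp [perimeter, filter_singleton, mul_comm]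

/-- The perimeter of the `n`-th set of the nested sequence `chain d`. -/
noncomputable def chainPerimeter (d n : ℕ) : ℕ := perimeter (chain d n)

theorem chainPerimeter_zero_left (n : ℕ) : chainPerimeter 0 n = 0 := by
  simp [chainPerimeter, perimeter]

theorem chainPerimeter_zero_right (d : ℕ) : chainPerimeter d 0 = 0 := by
  simp [chainPerimeter, chain_zero_right, perimeter]

theorem chainPerimeter_one_right (d : ℕ) : chainPerimeter d 1 = 2 * d :=
  perimeter_of_card_eq_one (card_chain fun _ ↦ le_rfl)

theorem chainPerimeter_boxCard_add (ha : 1 ≤ a) (hj : j ≤ d) (ht : t ≤ boxCard d a j) :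
    chainPerimeter (d + 1) (boxCard (d + 1) a j + t) =
      chainPerimeter (d + 1) (boxCard (d + 1) a j) + chainPerimeter d t := by
  lift j to Fin (d + 1) using Nat.lt_succ_of_le hj
  have h_subset : chain d t ⊆ box d a j := chain_boxCard ha hj ▸ chain_mono d ht
  simp only [chainPerimeter]
  rw [chain_boxCard_add ha ht, chain_boxCard ha (by omega)]
  refine perimeter_addLayer ?_ ?_ ?_ <;> simp [slice_box, ha, h_subset]

end Chain

/-! ### Carrying points between quasi-cubes -/

section CarryInequality

variable {a j n r t : ℕ}

/-- Moving as many of `r` points as fit onto a partial face of `t` points does not increase the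
total perimeter of nested sets in `ℤ^d`. -/
def CarryInequality (d : ℕ) : Prop :=
  ∀ ⦃a j t r : ℕ⦄, 1 ≤ a → j ≤ d → t ≤ boxCard d a j → r ≤ boxCard d a j →
    chainPerimeter d (min (boxCard d a j) (t + r)) + chainPerimeter d (t + r - boxCard d a j) ≤
      chainPerimeter d t + chainPerimeter d r

theorem CarryInequality.carry_face (hd : CarryInequality d) (ha : 1 ≤ a) (hj : j ≤ d)
    (ht : t ≤ boxCard d a j) (hr : r ≤ boxCard (d + 1) a (j + 1)) :
    chainPerimeter d (min (boxCard d a j) (t + r)) +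
        chainPerimeter (d + 1) (t + r - boxCard d a j) ≤
      chainPerimeter d t + chainPerimeter (d + 1) r := by
  induction r using Nat.strong_induction_on generalizing t with
  | _ r ih =>
  obtain rfl | rfl | h_two : r = 0 ∨ r = 1 ∨ 2 ≤ r := by omega
  · simp [ht, Nat.sub_eq_zero_of_le ht, chainPerimeter_zero_right]
  · obtain ht | rfl := ht.lt_or_eq
    · have h := hd (r := 1) ha hj ht.le (boxCard_pos ha)
      rw [Nat.sub_eq_zero_of_le ht, chainPerimeter_zero_right, chainPerimeter_one_right] at h ⊢
      omega
    · simp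
  obtain ⟨a', j', r', ha', hj', hr', hr'_le, rfl⟩ := exists_boxCard_add d h_two
  have h_face : boxCard d a' j' ≤ boxCard d a j := boxCard_face_le hj hj' (by omega)
  have h := hd ha hj ht (hr'_le.trans h_face)
  rw [chainPerimeter_boxCard_add ha' hj' hr'_le]
  obtain h_full | h_not_full := le_total (boxCard d a j) (t + r')
  · have h_sub : t + (boxCard (d + 1) a' j' + r') - boxCard d a j =
        boxCard (d + 1) a' j' + (t + r' - boxCard d a j) := by omega
    rw [min_eq_left h_full] at h
    rw [min_eq_left (by omega), h_sub, chainPerimeter_boxCard_add ha' hj' (by omega)]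
    omega
  · have h_rest := ih (boxCard (d + 1) a' j') (by omega) h_not_full (by omega)
    rw [min_eq_right h_not_full, Nat.sub_eq_zero_of_le h_not_full, chainPerimeter_zero_right] at h
    rw [add_left_comm, add_comm (boxCard _ _ _)]
    omega

theorem CarryInequality.carry_of_ge (hd : CarryInequality d) (ha : 1 ≤ a) (hj : j ≤ d)
    (hBt : boxCard (d + 1) a j ≤ t) (ht : t ≤ boxCard (d + 1) a (j + 1))
    (hr : r ≤ boxCard (d + 1) a (j + 1)) :
    chainPerimeter (d + 1) (min (boxCard (d + 1) a (j + 1)) (t + r)) +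
        chainPerimeter (d + 1) (t + r - boxCard (d + 1) a (j + 1)) ≤
      chainPerimeter (d + 1) t + chainPerimeter (d + 1) r := by
  obtain ⟨u, rfl⟩ := Nat.exists_eq_add_of_le hBt
  have h_face := boxCard_succ_succ (a := a) hj
  have hu : u ≤ boxCard d a j := by omega
  have h_min : min (boxCard (d + 1) a (j + 1)) (boxCard (d + 1) a j + u + r) =
      boxCard (d + 1) a j + min (boxCard d a j) (u + r) := by omega
  have h_sub : boxCard (d + 1) a j + u + r - boxCard (d + 1) a (j + 1) =
      u + r - boxCard d a j := by omega
  rw [h_min, h_sub, chainPerimeter_boxCard_add ha hj (min_le_left _ _),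
    chainPerimeter_boxCard_add ha hj hu]
  have := hd.carry_face ha hj hu hr
  omega

theorem CarryInequality.succ (hd : CarryInequality d) : CarryInequality (d + 1) := by
  intro a j t r ha hj ht hr
  induction h_card : boxCard (d + 1) a j using Nat.strong_induction_on generalizing a j t r with
  | _ F ih =>
  subst h_card
  obtain ⟨rfl, rfl⟩ | ⟨a', i, ha', hi, -, h_eq⟩ := exists_boxCard_pred ha hj
  · have h_one : boxCard (d + 1) 1 0 = 1 := by simp [boxCard]
    rw [h_one] at ht hr ⊢
    obtain rfl | rfl : t = 0 ∨ t = 1 := by omega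
    · simp [hr, Nat.sub_eq_zero_of_le hr, chainPerimeter_zero_right]
    · simp
  rw [h_eq] at ht hr ih ⊢
  have h_lt : boxCard (d + 1) a' i < boxCard (d + 1) a' (i + 1) := by
    rw [boxCard_succ_succ hi]
    exact Nat.lt_add_of_pos_right (boxCard_pos ha')
  set B := boxCard (d + 1) a' i with hB
  obtain htB | htB := le_total B t
  · exact hd.carry_of_ge ha' hi htB ht hr
  obtain hrB | hrB := le_total B r
  · rw [add_comm t r, add_comm (chainPerimeter (d + 1) t)]
    exact hd.carry_of_ge ha' hi hrB hr ht
  have h := ih B h_lt ha' (by omega) htB hrB rfl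
  obtain hs | hs := le_total (t + r) B
  · rw [min_eq_right hs, Nat.sub_eq_zero_of_le hs] at h
    rwa [min_eq_right (by omega), Nat.sub_eq_zero_of_le (by omega)]
  · rw [min_eq_left hs] at h
    have h_top := hd.carry_of_ge ha' hi le_rfl h_lt.le (r := t + r - B) (by omega)
    rw [← hB, Nat.add_sub_cancel' hs] at h_top
    exact h_top.trans h

theorem carryInequality : ∀ d, CarryInequality d
  | 0 => fun _ _ _ _ _ _ _ _ ↦ by simp [chainPerimeter_zero_left]
  | d + 1 => (carryInequality d).succ

theorem chainPerimeter_boxCard_add_le_of_le (ha : 1 ≤ a) (hj : j ≤ d) (ht : t ≤ boxCard d a j)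
    (hr : r ≤ t) :
    chainPerimeter (d + 1) (boxCard (d + 1) a j + t) ≤
      chainPerimeter (d + 1) (boxCard (d + 1) a j + t - r) + chainPerimeter d r := by
  have h := carryInequality d ha hj ((Nat.sub_le t r).trans ht) (hr.trans ht)
  rw [Nat.sub_add_cancel hr, min_eq_right ht, Nat.sub_eq_zero_of_le ht,
    chainPerimeter_zero_right] at h
  rw [Nat.add_sub_assoc hr, chainPerimeter_boxCard_add ha hj ht,
    chainPerimeter_boxCard_add ha hj (by omega)]
  omega

theorem chainPerimeter_boxCard_succ_add_le_of_ge (ha : 1 ≤ a) (hj : j ≤ d) (htr : t ≤ r)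
    (hr : r ≤ boxCard d a j) :
    chainPerimeter (d + 1) (boxCard (d + 1) a (j + 1)) + chainPerimeter d t ≤
      chainPerimeter (d + 1) (boxCard (d + 1) a (j + 1) + t - r) + chainPerimeter d r := by
  have h := carryInequality d ha hj (t := boxCard d a j + t - r) (by omega) hr
  rw [Nat.sub_add_cancel (by omega), min_eq_left (by omega), Nat.add_sub_cancel_left] at h
  have h_sub : boxCard (d + 1) a j + boxCard d a j + t - r =
      boxCard (d + 1) a j + (boxCard d a j + t - r) := by omega
  rw [boxCard_succ_succ hj, chainPerimeter_boxCard_add ha hj le_rfl, h_sub,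
    chainPerimeter_boxCard_add ha hj (by omega)]
  omega

theorem chainPerimeter_boxCard_succ_add_le_of_le {v : ℕ} (ha : 1 ≤ a) (hj : j ≤ d)
    (hvt : v ≤ t) (ht : t ≤ boxCard (d + 1) a j + v) (hv : v ≤ boxCard d a j)
    (h : chainPerimeter (d + 1) t ≤ chainPerimeter (d + 1) (t - v) + chainPerimeter d v) :
    chainPerimeter (d + 2) (boxCard (d + 2) a (j + 1)) + chainPerimeter (d + 1) t ≤
      chainPerimeter (d + 2) (boxCard (d + 2) a (j + 1) + t - (boxCard (d + 1) a j + v)) +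
        chainPerimeter (d + 1) (boxCard (d + 1) a j + v) := by
  have hj' : j ≤ d + 1 := by omega
  have h_sub : boxCard (d + 2) a j + boxCard (d + 1) a j + t - (boxCard (d + 1) a j + v) =
      boxCard (d + 2) a j + (t - v) := by omega
  rw [boxCard_succ_succ hj', h_sub, chainPerimeter_boxCard_add ha hj' le_rfl,
    chainPerimeter_boxCard_add ha hj' (by omega), chainPerimeter_boxCard_add ha hj hv]
  omega

theorem le_of_boxCard_lt_succ_pow (hj : j ≤ d) (h : boxCard d a j < (n + 1) ^ d) : a ≤ n := by
  by_contra! hna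
  exact h.not_ge ((Nat.pow_le_pow_left hna d).trans (pow_le_boxCard hj))

theorem le_boxCard_of_succ_mul_le (hj : j ≤ d) (ht : t ≤ boxCard d a j)
    (hr : (a + 1) * r ≤ boxCard (d + 1) a j + t) : r ≤ boxCard d a j := by
  rw [boxCard_succ_eq_mul hj] at hr
  nlinarith

theorem chainPerimeter_le_sub_add (ha : 1 ≤ a) (hn : n ≤ (a + 1) ^ (d + 1))
    (hr : (a + 1) * r ≤ n) :
    chainPerimeter (d + 1) n ≤ chainPerimeter (d + 1) (n - r) + chainPerimeter d r := by
  induction d using Nat.strong_induction_on generalizing a n r with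
  | _ d ih =>
  obtain rfl | hr_pos := r.eq_zero_or_pos
  · simp
  obtain ⟨c, j, t, hc, hj, ht_pos, ht, rfl⟩ := exists_boxCard_add d (n := n) (by nlinarith)
  have hca : c ≤ a := le_of_boxCard_lt_succ_pow (d := d + 1) (j := j) (by omega) (by omega)
  replace hr : (c + 1) * r ≤ boxCard (d + 1) c j + t :=
    (Nat.mul_le_mul_right r (by omega)).trans hr
  have hrF := le_boxCard_of_succ_mul_le hj ht hr
  obtain hrt | htr := le_or_gt r t
  · exact chainPerimeter_boxCard_add_le_of_le hc hj ht hrt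
  rw [chainPerimeter_boxCard_add hc hj ht]
  obtain ⟨rfl, rfl⟩ | ⟨b, i, hb, hi, hci, h_eq⟩ :=
    exists_boxCard_pred (d := d) hc (j := j) (by omega)
  · simp only [boxCard_zero_right, one_pow] at hrF
    omega
  rw [h_eq]
  obtain hrG | hGr := le_or_gt r (boxCard d b i)
  · exact chainPerimeter_boxCard_succ_add_le_of_ge hb hi htr.le hrG
  -- Here `r` is the face completed last plus `v` further points; by induction on the dimension
  -- those `v` points can be taken from the incomplete face.
  obtain ⟨rfl, rfl⟩ : c = b ∧ j = i + 1 := by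
    refine hci.resolve_right ?_
    rintro ⟨rfl, rfl, rfl⟩
    rw [boxCard_zero_right, ← boxCard_self] at hrF
    exact hGr.not_ge hrF
  obtain ⟨d, rfl⟩ := Nat.exists_eq_add_one.2 (Nat.lt_of_lt_of_le i.succ_pos hj)
  obtain ⟨v, rfl⟩ := Nat.exists_eq_add_of_le hGr.le
  have hv : (c + 1) * v ≤ t := by
    rw [boxCard_succ_succ_eq_mul] at hr
    linarith
  rw [boxCard_succ_succ (by omega)] at hrF
  exact chainPerimeter_boxCard_succ_add_le_of_le hc (by omega) (by nlinarith) htr.le (by omega)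
    (ih d d.lt_succ_self hc (ht.trans (boxCard_le_succ_pow hj)) hv)

end CarryInequality

/-! ### Nested minimizers -/

section Minimality

variable {a : ℕ}

theorem exists_lt_card_image {C : Finset (Fin d → ℤ)} (h : a ^ d < #C) :
    ∃ s, a < #(C.image (· s)) := by
  by_contra! h_le
  have h_subset : C ⊆ Fintype.piFinset fun s ↦ C.image (· s) := fun x hx ↦
    Fintype.mem_piFinset.2 fun s ↦ mem_image_of_mem (· s) hx
  refine h.not_ge ?_
  calc #C ≤ ∏ s, #(C.image (· s)) := (card_le_card h_subset).trans_eq (Fintype.card_piFinset _)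
    _ ≤ ∏ _s : Fin d, a := prod_le_prod' fun s _ ↦ h_le s
    _ = a ^ d := by simp

theorem exists_slice_card_mul_le {s : Fin (d + 1)} {C : Finset (Fin (d + 1) → ℤ)}
    (h : a < #(C.image (· s))) :
    ∃ k, 0 < #(slice s k C) ∧ (a + 1) * #(slice s k C) ≤ #C := by
  have mem_image_iff {k : ℤ} : k ∈ C.image (· s) ↔ slice s k C ≠ ∅ := by
    simp [slice]
  obtain ⟨k, hk, h_min⟩ := exists_min_image (C.image (· s)) (fun k ↦ #(slice s k C))
    (card_pos.1 (by omega))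
  refine ⟨k, card_pos.2 (nonempty_iff_ne_empty.2 (mem_image_iff.1 hk)), ?_⟩
  calc (a + 1) * #(slice s k C) ≤ #(C.image (· s)) * #(slice s k C) := Nat.mul_le_mul_right _ h
    _ ≤ ∑ l ∈ C.image (· s), #(slice s l C) := card_nsmul_le_sum _ _ _ h_min
    _ = #C := (card_eq_sum_slice fun l hl ↦ not_not.1 (mem_image_iff.not.1 hl)).symm

theorem chainPerimeter_card_le (d : ℕ) (C : Finset (Fin d → ℤ)) :
    chainPerimeter d #C ≤ perimeter C := by
  induction d with
  | zero => simp [chainPerimeter_zero_left]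
  | succ d ih_dim =>
    induction hn : #C using Nat.strong_induction_on generalizing C with
    | _ n ih_card =>
    obtain rfl | rfl | hn_two : n = 0 ∨ n = 1 ∨ 2 ≤ n := by omega
    · simp [chainPerimeter_zero_right]
    · rw [chainPerimeter_one_right, perimeter_of_card_eq_one hn]
    obtain ⟨a, j, t, ha, hj, ht_pos, ht, h_eq⟩ := exists_boxCard_add d hn_two
    have h_lower : a ^ (d + 1) < #C := by
      have : a ^ (d + 1) ≤ boxCard (d + 1) a j := pow_le_boxCard (by omega)
      omega
    have h_upper : n ≤ (a + 1) ^ (d + 1) := calc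
      n ≤ boxCard (d + 1) a (j + 1) := by rw [boxCard_succ_succ hj]; omega
      _ ≤ (a + 1) ^ (d + 1) := boxCard_le_succ_pow (by omega)
    obtain ⟨s, hs⟩ := exists_lt_card_image h_lower
    obtain ⟨k, hk_pos, hk⟩ := exists_slice_card_mul_le hs
    obtain ⟨D, hD_card, hD⟩ := exists_perimeter_add_slice_le s k C
    calc chainPerimeter (d + 1) n
        ≤ chainPerimeter (d + 1) (n - #(slice s k C)) + chainPerimeter d #(slice s k C) :=
          chainPerimeter_le_sub_add ha h_upper (hn ▸ hk)
      _ ≤ perimeter D + perimeter (slice s k C) :=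
          add_le_add (ih_card _ (by omega) D (by omega)) (ih_dim _)
      _ ≤ perimeter C := hD

/-- An increasing sequence of finite sets in `ℤ^d`, the `n`-th of which minimizes the edge
perimeter among the sets of `n` points. The conditions are imposed only on the cardinalities that
occur, since `ℤ^0` has no set of two points. -/
structure IsNestedMinimizing (c : ℕ → Finset (Fin d → ℤ)) : Prop where
  monotone : Monotone c
  card_eq : ∀ C : Finset (Fin d → ℤ), #(c (#C)) = #C
  perimeter_le : ∀ C : Finset (Fin d → ℤ), perimeter (c (#C)) ≤ perimeter C

theorem isNestedMinimizing_chain (d : ℕ) : IsNestedMinimizing (chain d) where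
  monotone := chain_mono d
  card_eq C := card_chain fun hd ↦ by
    subst hd
    exact card_le_one_of_subsingleton C
  perimeter_le := chainPerimeter_card_le d

variable {c : ℕ → Finset (Fin d → ℤ)}

theorem IsNestedMinimizing.card_symmDiff_le (hc : IsNestedMinimizing c)
    (A B : Finset (Fin d → ℤ)) : #(c (#A) ∆ c (#B)) ≤ #(A ∆ B) := by
  wlog h : #A ≤ #B generalizing A B
  · rw [symmDiff_comm, symmDiff_comm A]
    exact this B A (le_of_not_ge h)
  have h_subset : c (#A) ⊆ c (#B) := hc.monotone h
  calc #(c (#A) ∆ c (#B)) = #B - #A := by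
        rw [symmDiff_of_le h_subset, card_sdiff_of_subset h_subset, hc.card_eq, hc.card_eq]
    _ ≤ #(B \ A) := le_card_sdiff A B
    _ ≤ #(A ∆ B) := card_le_card subset_union_right

theorem IsNestedMinimizing.perimeter_slice_le (hc : IsNestedMinimizing c)
    {C : Finset (Fin (d + 1) → ℤ)}
    (hC : ∀ D : Finset (Fin (d + 1) → ℤ), #D = #C → perimeter C ≤ perimeter D)
    (s : Fin (d + 1)) (k : ℤ) {T : Finset (Fin d → ℤ)} (hT : #T = #(slice s k C)) :
    perimeter (slice s k C) ≤ perimeter T := by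
  obtain ⟨K, hkK, hK⟩ := exists_forall_notMem_slice_eq_empty s C {k}
  have h_empty {B : Finset (Fin d → ℤ)} (hB : B = ∅) : c (#B) = ∅ := by
    rw [← card_eq_zero, hc.card_eq, hB, card_empty]
  obtain ⟨D, hD⟩ := exists_forall_slice_eq s (K := K) (A := fun l ↦ c #(slice s l C))
    fun l hl ↦ h_empty (hK l hl).1
  have hDK : ∀ l ∉ K, slice s l D = ∅ ∧ slice s (l + 1) D = ∅ := fun l hl ↦ by
    simpa only [hD] using (hK l hl).imp h_empty h_empty
  have hD_card : #D = #C := by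
    rw [card_eq_sum_slice fun l hl ↦ (hDK l hl).1, card_eq_sum_slice fun l hl ↦ (hK l hl).1]
    simp only [hD, hc.card_eq]
  have h_perimeter (l : ℤ) : perimeter (slice s l D) ≤ perimeter (slice s l C) := by
    rw [hD]
    exact hc.perimeter_le _
  have h_symmDiff (l : ℤ) :
      #(slice s l D ∆ slice s (l + 1) D) ≤ #(slice s l C ∆ slice s (l + 1) C) := by
    rw [hD, hD]
    exact hc.card_symmDiff_le _ _
  by_contra! h_lt
  have h_slice_lt : perimeter (slice s k D) < perimeter (slice s k C) := by
    rw [hD, ← hT]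
    exact (hc.perimeter_le T).trans_lt h_lt
  refine (hC D hD_card).not_gt ?_
  rw [perimeter_eq_sum_slice hK, perimeter_eq_sum_slice hDK]
  exact sum_lt_sum (fun l _ ↦ add_le_add (h_perimeter l) (h_symmDiff l))
    ⟨k, hkK (mem_singleton_self k), add_lt_add_of_lt_of_le h_slice_lt (h_symmDiff k)⟩

end Minimality

end EdgeIso

theorem corollary3p3 (d : ℕ) (C : Set (Fin (d + 1) → ℤ)) (hC : EdgeIso.IsEIPMinimizer C)
    (s : Fin (d + 1)) (k : ℤ) :
    EdgeIso.IsEIPMinimizer (EdgeIso.dropCoord s '' EdgeIso.latticeSection C s k) := by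
  have hC_fin : C.Finite := by
    obtain rfl | ⟨-, h, -⟩ := hC
    · exact Set.finite_empty
    · exact h
  lift C to Finset (Fin (d + 1) → ℤ) using hC_fin
  rw [EdgeIso.isEIPMinimizer_coe_iff] at hC
  rw [← EdgeIso.coe_slice, EdgeIso.isEIPMinimizer_coe_iff]
  exact fun T hT ↦ (EdgeIso.isNestedMinimizing_chain d).perimeter_slice_le hC s k hT
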